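/- For each system size $L=0,1,2,\ldots$ let $E^{(L)}_1<\dots<E^{(L)}_{N_L}$ be real numbers (energies) that are linearly independent over $\mathbb{Q}$, let $d^{(L)}_1,\dots,d^{(L)}_{N_L}>0$ be weights, and let $n=n_L$ be integers with $1\le n_L\le N_L$. Write $\overline{f}=\lim_{T\to\infty}\frac1T\int_0^T f(t)\,dt$, and put $$Z_{n}(t)=\sum_{j=1}^{n}d_je^{-itE_j},\qquad \Delta Z_n=\Big(\overline{|Z_n|^2}\Big)^{1/2},\qquad Y_n=Z_n/\Delta Z_n,\qquad R_q^n=\frac{\sum_{j=1}^n d_j^{2q}}{\big(\sum_{j=1}^n d_j^2\big)^q},$$ where the superscript $L$ is suppressed. Let $P_{Y_n}$ be the time-averaged distribution of $Y_n$, that is, the probability measure on $\mathbb{C}\simeq\mathbb{R}^2$ with $\overline{f(Y_n)}=\int f\,dP_{Y_n}$ for all bounded continuous $f$. The weights satisfy the Lyapunov condition if $R_q^{n_L}\to0$ as $L\to\infty$ for some real $q>1$. Then: (0) for every $L$, the time average $\overline{|Z_n|^2}$ exists and equals $\sum_{j=1}^n d_j^2$, and $P_{Y_n}$ exists and is unique;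 (i) if the Lyapunov condition holds, then $P_{Y_{n_L}}$ converges in distribution, as $L\to\infty$, to the standard two-dimensional Gaussian with density $\frac1\pi e^{-\|y\|^2}$; (ii) conversely, if the Lyapunov condition fails, then $P_{Y_{n_L}}$ does not converge in distribution to any Gaussian measure on $\mathbb{R}^2$ (so a limiting distribution, if there is one, is not Gaussian); (iii) if $R_q^{n_L}\to0$ for one real $q>1$, then $R_p^{n_L}\to0$ for all real $p>1$. -/

import Mathlib

open Filter Topology MeasureTheory ProbabilityTheory
open scoped BoundedContinuousFunction

noncomputable section

namespace SpectralWalk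

/-- The spectral data of one finite system: distinct energies in ascending order
`E_1 < ⋯ < E_N` and positive weights `d_1, …, d_N` (indices are shifted by one). -/
structure SpectralData where
  /-- number of distinct energy levels -/
  numLevels : ℕ
  /-- the energies -/
  energy : Fin numLevels → ℝ
  /-- the weights -/
  weight : Fin numLevels → ℝ
  energy_strictMono : StrictMono energy
  weight_pos : ∀ j, 0 < weight j

/-- The infinite time average `lim_{T → ∞} (1/T) ∫₀ᵀ f(t) dt` exists and equals `a`. -/
def HasTimeAverage (f : ℝ → ℝ) (a : ℝ) : Prop :=
  Tendsto (fun T : ℝ => T⁻¹ * ∫ t in (0 : ℝ)..T, f t) atTop (𝓝 a)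

/-- The value of the infinite time average `lim_{T → ∞} (1/T) ∫₀ᵀ f(t) dt`
(meaningful when the limit exists). -/
def timeAverage (f : ℝ → ℝ) : ℝ :=
  limUnder atTop (fun T : ℝ => T⁻¹ * ∫ t in (0 : ℝ)..T, f t)

/-- `P` is the distribution of `Y` when time is subject to the infinite time average:
the time average of `f (Y t)` exists and equals the expectation of `f` under `P`, for every
bounded continuous `f`. -/
def IsTimeLaw (Y : ℝ → ℂ) (P : ProbabilityMeasure ℂ) : Prop :=
  ∀ f : ℂ →ᵇ ℝ, HasTimeAverage (fun t => f (Y t)) (∫ y, f y ∂(P : Measure ℂ))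

/-- Position of the walker after `n` steps: `Z_n(t) = ∑_{j ≤ n} d_j e^{-i t E_j}`. -/
def position (S : SpectralData) (n : ℕ) (t : ℝ) : ℂ :=
  ∑ j : Fin S.numLevels with j.val < n,
    (S.weight j : ℂ) * Complex.exp (-Complex.I * (t : ℂ) * (S.energy j : ℂ))

/-- `ΔZ_n`, the square root of the time average of `|Z_n(t)|²`. -/
def spread (S : SpectralData) (n : ℕ) : ℝ :=
  Real.sqrt (timeAverage (fun t => ‖position S n t‖ ^ 2))

/-- The rescaled walker `Y_n = Z_n / ΔZ_n`. -/
def rescaled (S : SpectralData) (n : ℕ) (t : ℝ) : ℂ :=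
  position S n t / (spread S n : ℂ)

/-- `R_q^n = (∑_{j ≤ n} d_j^{2q}) / (∑_{j ≤ n} d_j²)^q`. -/
def lyapunovRatio (S : SpectralData) (n : ℕ) (q : ℝ) : ℝ :=
  (∑ j : Fin S.numLevels with j.val < n, S.weight j ^ (2 * q)) /
    (∑ j : Fin S.numLevels with j.val < n, S.weight j ^ 2) ^ q

/-- The Lyapunov condition for the family of systems `S L` observed after `n L` steps. -/
def LyapunovCondition (S : ℕ → SpectralData) (n : ℕ → ℕ) : Prop :=
  ∃ q : ℝ, 1 < q ∧ Tendsto (fun L => lyapunovRatio (S L) (n L) q) atTop (𝓝 0)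

/-- The measure on `ℂ ≃ ℝ²` with Lebesgue density `(1/π) e^{-|y|²}`. -/
def gaussianMeasure : Measure ℂ :=
  volume.withDensity (fun y => ENNReal.ofReal (1 / Real.pi * Real.exp (-‖y‖ ^ 2)))

theorem isProbabilityMeasure_gaussianMeasure : IsProbabilityMeasure gaussianMeasure := by
  have hI : ∫ y : ℂ, Real.exp (-‖y‖ ^ 2) = Real.pi := by
    have h := GaussianFourier.integral_rexp_neg_mul_sq_norm (V := ℂ) (b := 1) one_pos
    simpa using h
  have hint : Integrable (fun y : ℂ => Real.exp (-‖y‖ ^ 2)) := by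
    by_contra h
    rw [integral_undef h] at hI
    exact Real.pi_ne_zero hI.symm
  constructor
  rw [gaussianMeasure, withDensity_apply _ MeasurableSet.univ, Measure.restrict_univ,
    ← ofReal_integral_eq_lintegral_ofReal (hint.const_mul _)
      (Eventually.of_forall fun y => by positivity), integral_const_mul, hI]
  simp [Real.pi_ne_zero]

/-- The standard two-dimensional (circular complex) Gaussian distribution, with density
`(1/π) e^{-|y|²}`. -/
def standardGaussian : ProbabilityMeasure ℂ :=
  ⟨gaussianMeasure, isProbabilityMeasure_gaussianMeasure⟩

end SpectralWalk

end

/-! Rational independence of the energies makes the phases equidistribute on a torus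
(`tendsto_average_torusFlow`), so the time law of `Y_n` is that of `∑ c_j U_j`, with `U_j`
independent and uniform on the unit circle and `∑ c_j² = 1`. Its characteristic function is `∏
J₀(c_j |ξ|)` (`charFun_circleSumLaw`).

For `|x| ≤ 1`, `J₀(x)` lies between `exp(-(x²/4 + x⁴/a))` with `a = 16` and `a = 256`. In the
product the quadratic terms add up to `r²/4` exactly, and the deviation from the Gaussian is
controlled from both sides by `r⁴ ∑ c_j⁴` (`prod_besselMean_bounds`). But `∑ c_j⁴` is the Lyapunov
ratio at `q = 2`. If it tends to 0, Lévy's continuity theorem gives the Gaussian limit; a Gaussian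
limit conversely must have the matching variance, and the upper bound at `r = 1` then forces `∑ c_j⁴
→ 0`. All exponents are equivalent because each ratio controls the largest `c_j²`
(`sum_rpow_le_of_sum_eq_one`). -/

namespace SpectralWalk

/-! ### The Bessel mean: circle moments and two-sided exponential bounds. -/

/-- The average of `cos (x cos θ)` over the angle `θ`, i.e. the Bessel function `J₀`. -/
noncomputable def besselMean (x : ℝ) : ℝ :=
  ∫ y : UnitAddCircle, Real.cos (x * (fourier 1 y : ℂ).re) ∂AddCircle.haarAddCircle

theorem integral_fourier_haarAddCircle (k : ℤ) :
    ∫ y : UnitAddCircle, (fourier k y : ℂ) ∂AddCircle.haarAddCircle = if k = 0 then 1 else 0 := by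
  split_ifs with h
  · simp [h]
  · exact integral_eq_zero_of_add_right_eq_neg (fourier_add_half_inv_index h one_pos)

theorem integrable_haarAddCircle_of_continuous {E : Type*} [NormedAddCommGroup E]
    {f : UnitAddCircle → E} (hf : Continuous f) : Integrable f AddCircle.haarAddCircle :=
  hf.integrable_of_hasCompactSupport (HasCompactSupport.of_compactSpace f)

theorem integral_re_fourier (k : ℤ) (hk : k ≠ 0) :
    ∫ y : UnitAddCircle, (fourier k y : ℂ).re ∂AddCircle.haarAddCircle = 0 := by
  have h := integral_re (𝕜 := ℂ)
    (integrable_haarAddCircle_of_continuous (fourier (T := 1) k).continuous)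
  refine h.trans ?_
  rw [integral_fourier_haarAddCircle, if_neg hk, map_zero]

theorem norm_fourier_apply (k : ℤ) (y : UnitAddCircle) : ‖(fourier k y : ℂ)‖ = 1 := by
  rw [fourier_apply]; exact Circle.norm_coe _

theorem re_fourier_two (y : UnitAddCircle) :
    (fourier 2 y : ℂ).re = 2 * (fourier 1 y : ℂ).re ^ 2 - 1 := by
  have h1 : (fourier 2 y : ℂ) = fourier 1 y * fourier 1 y := by rw [← fourier_add]; rfl
  have h2 : Complex.normSq (fourier 1 y) = 1 := by
    rw [Complex.normSq_eq_norm_sq, norm_fourier_apply, one_pow]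
  rw [Complex.normSq_apply] at h2
  rw [h1, Complex.mul_re]
  linarith

theorem re_fourier_four (y : UnitAddCircle) :
    (fourier 4 y : ℂ).re = 2 * (fourier 2 y : ℂ).re ^ 2 - 1 := by
  have h1 : (fourier 4 y : ℂ) = fourier 2 y * fourier 2 y := by rw [← fourier_add]; rfl
  have h2 : Complex.normSq (fourier 2 y) = 1 := by
    rw [Complex.normSq_eq_norm_sq, norm_fourier_apply, one_pow]
  rw [Complex.normSq_apply] at h2
  rw [h1, Complex.mul_re]
  linarith

theorem integral_re_fourier_one_sq :
    ∫ y : UnitAddCircle, (fourier 1 y : ℂ).re ^ 2 ∂AddCircle.haarAddCircle = 1 / 2 := by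
  have h : ∀ y : UnitAddCircle,
      (fourier 1 y : ℂ).re ^ 2 = 1 / 2 + 1 / 2 * (fourier 2 y : ℂ).re := fun y => by
    rw [re_fourier_two]; ring
  simp_rw [h]
  rw [integral_add (integrable_haarAddCircle_of_continuous (by fun_prop))
    (integrable_haarAddCircle_of_continuous (by fun_prop)), integral_const_mul,
    integral_re_fourier 2 two_ne_zero]
  simp

theorem integral_re_fourier_one_pow_four :
    ∫ y : UnitAddCircle, (fourier 1 y : ℂ).re ^ 4 ∂AddCircle.haarAddCircle = 3 / 8 := by
  have h : ∀ y : UnitAddCircle, (fourier 1 y : ℂ).re ^ 4 =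
      3 / 8 + (1 / 2 * (fourier 2 y : ℂ).re + 1 / 8 * (fourier 4 y : ℂ).re) := fun y => by
    rw [re_fourier_four, re_fourier_two]; ring
  simp_rw [h]
  rw [integral_add (integrable_haarAddCircle_of_continuous (by fun_prop))
    (integrable_haarAddCircle_of_continuous (by fun_prop)),
    integral_add (integrable_haarAddCircle_of_continuous (by fun_prop))
    (integrable_haarAddCircle_of_continuous (by fun_prop)), integral_const_mul, integral_const_mul,
    integral_re_fourier 2 two_ne_zero, integral_re_fourier 4 four_ne_zero]
  simp

theorem one_sub_le_besselMean (x : ℝ) : 1 - x ^ 2 / 4 ≤ besselMean x := by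
  have h : ∫ y : UnitAddCircle, (1 - x ^ 2 / 2 * (fourier 1 y : ℂ).re ^ 2)
      ∂AddCircle.haarAddCircle = 1 - x ^ 2 / 4 := by
    rw [integral_sub (integrable_const _)
      (integrable_haarAddCircle_of_continuous (by fun_prop)), integral_const_mul,
      integral_re_fourier_one_sq]
    simp; ring
  rw [← h]
  refine integral_mono (integrable_haarAddCircle_of_continuous (by fun_prop))
    (integrable_haarAddCircle_of_continuous (by fun_prop)) fun y => ?_
  have := Real.one_sub_sq_div_two_le_cos (x := x * (fourier 1 y : ℂ).re)
  simp only
  linarith [mul_pow x (fourier 1 y : ℂ).re 2]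

theorem besselMean_le {x : ℝ} (hx : |x| ≤ 1) :
    besselMean x ≤ 1 - x ^ 2 / 4 + 5 / 256 * x ^ 4 := by
  -- `5/96` is the constant in `Real.cos_bound`; times the fourth moment `3/8` it gives `5/256`.
  have h : ∫ y : UnitAddCircle, (1 - x ^ 2 / 2 * (fourier 1 y : ℂ).re ^ 2 +
      5 / 96 * x ^ 4 * (fourier 1 y : ℂ).re ^ 4) ∂AddCircle.haarAddCircle =
      1 - x ^ 2 / 4 + 5 / 256 * x ^ 4 := by
    rw [integral_add (integrable_haarAddCircle_of_continuous (by fun_prop))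
      (integrable_haarAddCircle_of_continuous (by fun_prop)), integral_sub (integrable_const _)
      (integrable_haarAddCircle_of_continuous (by fun_prop)), integral_const_mul,
      integral_const_mul, integral_re_fourier_one_sq, integral_re_fourier_one_pow_four]
    simp; ring
  rw [← h]
  refine integral_mono (integrable_haarAddCircle_of_continuous (by fun_prop))
    (integrable_haarAddCircle_of_continuous (by fun_prop)) fun y => ?_
  have hy : |(fourier 1 y : ℂ).re| ≤ 1 := (Complex.abs_re_le_norm _).trans (norm_fourier_apply 1 y).le
  have hxy : |x * (fourier 1 y : ℂ).re| ≤ 1 := by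
    rw [abs_mul]; exact mul_le_one₀ hx (abs_nonneg _) hy
  have := (abs_le.1 (Real.cos_bound hxy)).2
  rw [Even.pow_abs (by decide)] at this
  simp only
  linarith [mul_pow x (fourier 1 y : ℂ).re 2, mul_pow x (fourier 1 y : ℂ).re 4]

theorem exp_le_besselMean {x : ℝ} (hx : |x| ≤ 1) :
    Real.exp (-(x ^ 2 / 4 + x ^ 4 / 16)) ≤ besselMean x := by
  refine le_trans ?_ (one_sub_le_besselMean x)
  have hx2 : x ^ 2 ≤ 1 := (sq_le_one_iff_abs_le_one x).2 hx
  set s := x ^ 2 / 4 with hs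
  have h4 : x ^ 4 / 16 = s ^ 2 := by rw [hs]; ring
  have hs0 : 0 ≤ s := by positivity
  have hs1 : s ≤ 1 / 4 := by linarith
  rw [h4, Real.exp_neg, inv_le_comm₀ (Real.exp_pos _) (by linarith)]
  have h1 := Real.quadratic_le_exp_of_nonneg (x := s + s ^ 2) (by positivity)
  rw [inv_le_iff_one_le_mul₀ (by linarith)]
  refine le_trans ?_ (mul_le_mul_of_nonneg_right h1 (by linarith))
  nlinarith [pow_nonneg hs0 2, pow_nonneg hs0 3, pow_nonneg hs0 4,
    mul_nonneg (pow_nonneg hs0 2) (sub_nonneg.2 hs1),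
    mul_nonneg (pow_nonneg hs0 3) (sub_nonneg.2 hs1),
    mul_nonneg (pow_nonneg hs0 4) (sub_nonneg.2 hs1)]

/-- With `s = x²/4`, the polynomial bound is `1 - s + (5/16)s²`, while the exponential is `1 - s +
(7/16)s² + O(s³)`; the gap in the quadratic coefficient absorbs the higher terms for `s ≤ 1/4`. -/
theorem besselMean_le_exp {x : ℝ} (hx : |x| ≤ 1) :
    besselMean x ≤ Real.exp (-(x ^ 2 / 4 + x ^ 4 / 256)) := by
  refine (besselMean_le hx).trans ?_
  have hx2 : x ^ 2 ≤ 1 := (sq_le_one_iff_abs_le_one x).2 hx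
  set s := x ^ 2 / 4 with hs
  have h4 : x ^ 4 = 16 * s ^ 2 := by rw [hs]; ring
  have hs0 : 0 ≤ s := by positivity
  have hs1 : s ≤ 1 / 4 := by linarith
  rw [h4, Real.exp_neg, le_inv_comm₀ (by nlinarith) (Real.exp_pos _)]
  have hy : s + 16 * s ^ 2 / 256 ≤ 1 := by nlinarith
  have h1 := Real.exp_bound' (x := s + 16 * s ^ 2 / 256) (by positivity) hy (n := 3) (by norm_num)
  simp only [Finset.sum_range_succ, Finset.sum_range_zero, Nat.factorial] at h1
  norm_num at h1
  refine h1.trans ?_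
  rw [le_inv_comm₀ (by positivity) (by nlinarith), ← one_div, le_div_iff₀ (by positivity)]
  have hb : ∀ k : ℕ, s ^ (k + 4) ≤ 1 / 4 * s ^ (k + 3) := fun k => by
    rw [pow_succ s (k + 3)]; nlinarith [pow_nonneg hs0 (k + 3)]
  have h2 : s ^ 3 ≤ 1 / 4 * s ^ 2 := by nlinarith [pow_nonneg hs0 2]
  have := hb 0; have := hb 1; have := hb 2; have := hb 3; have := hb 4
  have := pow_nonneg hs0 2
  have := pow_nonneg hs0 3
  have := pow_nonneg hs0 4
  have := pow_nonneg hs0 5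
  have := pow_nonneg hs0 6
  have := pow_nonneg hs0 7
  have := pow_nonneg hs0 8
  ring_nf at *
  nlinarith

theorem exists_eq_norm_mul_fourier (ξ : ℂ) :
    ∃ θ : UnitAddCircle, ξ = ‖ξ‖ * fourier 1 θ := by
  refine ⟨((Complex.arg ξ / (2 * Real.pi) : ℝ) : UnitAddCircle), ?_⟩
  rw [fourier_coe_apply]
  conv_lhs => rw [← Complex.norm_mul_exp_arg_mul_I ξ]
  congr 2
  have := Real.pi_ne_zero
  push_cast
  field_simp

/-- Rotation invariance of Haar measure removes the argument of `ξ`, and the sine part is odd under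
a half turn. -/
theorem integral_exp_inner_fourier (c : ℝ) (ξ : ℂ) :
    ∫ y : UnitAddCircle, Complex.exp (inner ℝ (c * fourier (-1) y : ℂ) ξ * Complex.I)
      ∂AddCircle.haarAddCircle = besselMean (c * ‖ξ‖) := by
  obtain ⟨θ, hθ⟩ := exists_eq_norm_mul_fourier ξ
  have h1 : ∀ y : UnitAddCircle, inner ℝ (c * fourier (-1) y : ℂ) ξ =
      c * ‖ξ‖ * (fourier 1 (y + θ) : ℂ).re := fun y => by
    have : (fourier 1 (y + θ) : ℂ) = fourier 1 y * fourier 1 θ := by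
      rw [fourier_one, fourier_one, fourier_one, AddCircle.toCircle_add]; rfl
    rw [this, Complex.inner, fourier_neg, map_mul, Complex.conj_conj, Complex.conj_ofReal]
    conv_lhs => rw [hθ]
    rw [show (‖ξ‖ * fourier 1 θ * (c * fourier 1 y) : ℂ) =
      ((c * ‖ξ‖ : ℝ) : ℂ) * (fourier 1 y * fourier 1 θ) by push_cast; ring, Complex.re_ofReal_mul]
  simp_rw [h1]
  rw [integral_add_right_eq_self (μ := AddCircle.haarAddCircle)
    (fun y : UnitAddCircle =>
      Complex.exp ((c * ‖ξ‖ * (fourier 1 y : ℂ).re : ℝ) * Complex.I)) θ]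
  generalize c * ‖ξ‖ = x
  simp_rw [Complex.exp_mul_I, ← Complex.ofReal_cos, ← Complex.ofReal_sin]
  rw [integral_add (integrable_haarAddCircle_of_continuous (by fun_prop))
    (integrable_haarAddCircle_of_continuous (by fun_prop)), integral_mul_const,
    integral_complex_ofReal, integral_complex_ofReal]
  have h2 : ∫ y : UnitAddCircle, Real.sin (x * (fourier 1 y : ℂ).re)
      ∂AddCircle.haarAddCircle = 0 := by
    refine integral_eq_zero_of_add_right_eq_neg (g := ((1 / 2 / (1 : ℤ) : ℝ) : UnitAddCircle))
      fun y => ?_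
    rw [fourier_add_half_inv_index one_ne_zero one_pos]
    simp
  rw [h2, besselMean]
  simp

/-! ### Equidistribution on the torus and the law of the random sum. -/

section Torus

variable {ι : Type*}

/-- The linear flow on the torus with frequencies `E / 2π`. -/
noncomputable def torusFlow (E : ι → ℝ) (t : ℝ) : UnitAddTorus ι :=
  fun j => ((t * E j / (2 * Real.pi) : ℝ) : UnitAddCircle)

theorem continuous_torusFlow (E : ι → ℝ) : Continuous (torusFlow E) :=
  continuous_pi fun _ => (AddCircle.continuous_mk' 1).comp (by fun_prop)

theorem fourier_torusFlow (E : ι → ℝ) (k : ℤ) (t : ℝ) (j : ι) :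
    (fourier k (torusFlow E t j) : ℂ) = Complex.exp (Complex.I * (k * E j) * t) := by
  rw [torusFlow, fourier_coe_apply]
  congr 1
  have := Real.pi_ne_zero
  push_cast
  field_simp

variable [Fintype ι]

/-- The uniform probability measure on the torus `(ℝ/ℤ)^ι`. -/
noncomputable def torusMeasure (ι : Type*) [Fintype ι] : Measure (UnitAddTorus ι) :=
  Measure.pi fun _ => AddCircle.haarAddCircle

instance : IsProbabilityMeasure (torusMeasure ι) :=
  inferInstanceAs (IsProbabilityMeasure (Measure.pi _))

theorem integrable_torusMeasure_of_continuous {F : Type*} [NormedAddCommGroup F]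
    {f : UnitAddTorus ι → F} (hf : Continuous f) : Integrable f (torusMeasure ι) :=
  hf.integrable_of_hasCompactSupport (HasCompactSupport.of_compactSpace f)

theorem mFourier_torusFlow (E : ι → ℝ) (k : ι → ℤ) (t : ℝ) :
    UnitAddTorus.mFourier k (torusFlow E t) =
      Complex.exp (Complex.I * ((∑ j, k j * E j : ℝ) : ℂ) * t) := by
  simp only [UnitAddTorus.mFourier, ContinuousMap.coe_mk, fourier_torusFlow]
  rw [← Complex.exp_sum]
  congr 1
  push_cast
  rw [Finset.mul_sum, Finset.sum_mul]

theorem integral_mFourier_torusMeasure (k : ι → ℤ) :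
    ∫ x, UnitAddTorus.mFourier k x ∂torusMeasure ι = if k = 0 then 1 else 0 := by
  simp only [UnitAddTorus.mFourier, ContinuousMap.coe_mk, torusMeasure]
  rw [integral_fintype_prod_eq_prod (fun j (y : UnitAddCircle) => (fourier (k j) y : ℂ))]
  simp_rw [integral_fourier_haarAddCircle]
  split_ifs with h
  · simp [h]
  · obtain ⟨j, hj⟩ := Function.ne_iff.1 h
    exact Finset.prod_eq_zero (Finset.mem_univ j) (if_neg hj)

/-- The time average of a pure oscillation vanishes unless the frequency is zero. -/
theorem tendsto_average_exp (w : ℝ) :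
    Tendsto (fun T : ℝ => (T : ℂ)⁻¹ * ∫ t in (0 : ℝ)..T, Complex.exp (Complex.I * w * t)) atTop
      (𝓝 (if w = 0 then 1 else 0)) := by
  split_ifs with h
  · refine tendsto_const_nhds.congr' ?_
    filter_upwards [eventually_gt_atTop 0] with T hT
    have : (T : ℂ) ≠ 0 := by exact_mod_cast hT.ne'
    simp [h, this]
  · have hw : Complex.I * (w : ℂ) ≠ 0 := by simp [h]
    simp_rw [integral_exp_mul_complex hw]
    have hlim : Tendsto (fun T : ℝ => (T⁻¹ * (2 / |w|) : ℝ)) atTop (𝓝 0) := by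
      simpa using tendsto_inv_atTop_zero.mul_const (2 / |w|)
    refine squeeze_zero_norm' ?_ hlim
    filter_upwards [eventually_gt_atTop 0] with T hT
    rw [norm_mul, norm_inv, norm_div, Complex.norm_real, Real.norm_of_nonneg hT.le]
    have h1 : ‖Complex.I * (w : ℂ)‖ = |w| := by simp
    rw [h1]
    gcongr
    refine (norm_sub_le _ _).trans ?_
    have h2 : Complex.I * w * T = ((w * T : ℝ) : ℂ) * Complex.I := by push_cast; ring
    rw [h2, Complex.norm_exp_ofReal_mul_I]
    simp
    norm_num

theorem norm_average_le {f : ℝ → ℂ} {C : ℝ} (hf : ∀ t, ‖f t‖ ≤ C) {T : ℝ} (hT : 0 < T) :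
    ‖(T : ℂ)⁻¹ * ∫ t in (0 : ℝ)..T, f t‖ ≤ C := by
  have h := intervalIntegral.norm_integral_le_of_norm_le_const (a := 0) (b := T) (f := f)
    (C := C) fun t _ => hf t
  rw [norm_mul, norm_inv, Complex.norm_real, Real.norm_of_nonneg hT.le, inv_mul_le_iff₀ hT]
  rwa [sub_zero, abs_of_pos hT, mul_comm] at h

/-- The Kronecker–Weyl equidistribution theorem for linear flows on the torus. -/
theorem tendsto_average_torusFlow {E : ι → ℝ} (hE : LinearIndependent ℚ E)
    (f : C(UnitAddTorus ι, ℂ)) :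
    Tendsto (fun T : ℝ => (T : ℂ)⁻¹ * ∫ t in (0 : ℝ)..T, f (torusFlow E t)) atTop
      (𝓝 (∫ x, f x ∂torusMeasure ι)) := by
  have hint : ∀ (g : C(UnitAddTorus ι, ℂ)) (T : ℝ),
      IntervalIntegrable (fun t => g (torusFlow E t)) volume 0 T := fun g T =>
    (g.continuous.comp (continuous_torusFlow E)).intervalIntegrable _ _
  have hintT : ∀ g : C(UnitAddTorus ι, ℂ), Integrable g (torusMeasure ι) := fun g =>
    integrable_torusMeasure_of_continuous g.continuous
  have hspan : ∀ p ∈ Submodule.span ℂ (Set.range (UnitAddTorus.mFourier (d := ι))),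
      Tendsto (fun T : ℝ => (T : ℂ)⁻¹ * ∫ t in (0 : ℝ)..T, p (torusFlow E t)) atTop
        (𝓝 (∫ x, p x ∂torusMeasure ι)) := by
    intro p hp
    induction hp using Submodule.span_induction with
    | mem p hp =>
      obtain ⟨k, rfl⟩ := hp
      simp_rw [mFourier_torusFlow, integral_mFourier_torusMeasure]
      -- Rational independence enters here: only the trivial character has zero frequency along the
      -- flow.
      have hk : k = 0 ↔ ∑ j, (k j : ℝ) * E j = 0 := by
        refine ⟨fun h => by simp [h], fun h => funext fun j => ?_⟩
        have := Fintype.linearIndependent_iff.1 hE (fun j => (k j : ℚ))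
          (by simpa [Rat.smul_def] using h) j
        exact_mod_cast this
      simp_rw [hk]
      exact tendsto_average_exp _
    | zero => simp
    | add p q _ _ hp hq =>
      have hsum := hp.add hq
      rw [← integral_add (hintT p) (hintT q)] at hsum
      refine hsum.congr fun T => ?_
      simp only [ContinuousMap.add_apply]
      rw [intervalIntegral.integral_add (hint p T) (hint q T), mul_add]
    | smul c p _ hp =>
      have hmul := hp.const_mul c
      rw [← integral_const_mul] at hmul
      refine hmul.congr fun T => ?_
      simp only [ContinuousMap.smul_apply, smul_eq_mul]
      rw [intervalIntegral.integral_const_mul]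
      ring
  have hf : f ∈ closure
      (Submodule.span ℂ (Set.range (UnitAddTorus.mFourier (d := ι))) : Set C(UnitAddTorus ι, ℂ)) := by
    rw [← Submodule.topologicalClosure_coe, UnitAddTorus.span_mFourier_closure_eq_top]
    trivial
  rw [Metric.tendsto_nhds]
  intro ε hε
  obtain ⟨p, hp, hfp⟩ := Metric.mem_closure_iff.1 hf (ε / 3) (by positivity)
  have hle : ∀ x, ‖f x - p x‖ ≤ ε / 3 := fun x => by
    rw [← dist_eq_norm]; exact (ContinuousMap.dist_apply_le_dist x).trans hfp.le
  filter_upwards [Metric.tendsto_nhds.1 (hspan p hp) (ε / 3) (by positivity),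
    eventually_gt_atTop 0] with T hT hT0
  have h1 := norm_average_le (fun t => hle (torusFlow E t)) hT0
  rw [intervalIntegral.integral_sub (hint f T) (hint p T), mul_sub] at h1
  have h2 : ‖∫ x, (f x - p x) ∂torusMeasure ι‖ ≤ ε / 3 := by
    simpa using norm_integral_le_of_norm_le_const (μ := torusMeasure ι)
      (Eventually.of_forall hle)
  rw [integral_sub (hintT f) (hintT p), norm_sub_rev] at h2
  rw [dist_eq_norm] at hT ⊢
  refine (norm_sub_le_norm_sub_add_norm_sub _
    ((T : ℂ)⁻¹ * ∫ t in (0 : ℝ)..T, p (torusFlow E t)) _).trans_lt ?_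
  have h3 := norm_sub_le_norm_sub_add_norm_sub
    ((T : ℂ)⁻¹ * ∫ t in (0 : ℝ)..T, p (torusFlow E t)) (∫ x, p x ∂torusMeasure ι)
    (∫ x, f x ∂torusMeasure ι)
  linarith

/-- The linear combination `∑ c_j e^{-2πi x_j}` of coordinates on the torus. -/
noncomputable def torusSum (c : ι → ℝ) (x : UnitAddTorus ι) : ℂ :=
  ∑ j, (c j : ℂ) * fourier (-1) (x j)

@[fun_prop]
theorem continuous_torusSum (c : ι → ℝ) : Continuous (torusSum c) := by
  unfold torusSum; fun_prop

/-- The distribution of `∑ c_j U_j` with `U_j` independent and uniform on the unit circle. -/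
noncomputable def circleSumLaw (c : ι → ℝ) : ProbabilityMeasure ℂ :=
  ⟨(torusMeasure ι).map (torusSum c),
    Measure.isProbabilityMeasure_map (by fun_prop)⟩

theorem torusSum_torusFlow (E c : ι → ℝ) (t : ℝ) :
    torusSum c (torusFlow E t) = ∑ j, (c j : ℂ) * Complex.exp (-Complex.I * t * E j) := by
  unfold torusSum
  refine Finset.sum_congr rfl fun j _ => ?_
  rw [fourier_torusFlow]
  push_cast
  ring_nf

theorem isTimeLaw_circleSumLaw {E : ι → ℝ} (hE : LinearIndependent ℚ E) (c : ι → ℝ) :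
    IsTimeLaw (fun t => ∑ j, (c j : ℂ) * Complex.exp (-Complex.I * t * E j)) (circleSumLaw c) := by
  intro f
  have h := tendsto_average_torusFlow hE
    ⟨fun x => (f (torusSum c x) : ℂ), by fun_prop⟩
  simp only [ContinuousMap.coe_mk, torusSum_torusFlow, intervalIntegral.integral_ofReal,
    integral_complex_ofReal] at h
  rw [circleSumLaw, ProbabilityMeasure.coe_mk, integral_map (by fun_prop)
    f.continuous.aestronglyMeasurable]
  unfold HasTimeAverage
  exact_mod_cast Complex.continuous_re.continuousAt.tendsto.comp h

theorem IsTimeLaw.unique {Y : ℝ → ℂ} {P Q : ProbabilityMeasure ℂ} (hP : IsTimeLaw Y P)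
    (hQ : IsTimeLaw Y Q) : P = Q := by
  have h : (P : Measure ℂ) = Q :=
    ext_of_forall_integral_eq_of_IsFiniteMeasure fun f => tendsto_nhds_unique (hP f) (hQ f)
  exact Subtype.ext h

theorem charFun_circleSumLaw (c : ι → ℝ) (ξ : ℂ) :
    charFun (circleSumLaw c : Measure ℂ) ξ = ((∏ j, besselMean (c j * ‖ξ‖) : ℝ) : ℂ) := by
  rw [charFun_apply, circleSumLaw, ProbabilityMeasure.coe_mk, integral_map (by fun_prop)
    (Continuous.aestronglyMeasurable (by fun_prop))]
  have h : ∀ x : UnitAddTorus ι, Complex.exp (inner ℝ (torusSum c x) ξ * Complex.I) =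
      ∏ j, Complex.exp (inner ℝ (c j * fourier (-1) (x j) : ℂ) ξ * Complex.I) := fun x => by
    rw [torusSum, sum_inner, ← Complex.exp_sum]
    push_cast
    rw [Finset.sum_mul]
  simp_rw [h]
  rw [torusMeasure, integral_fintype_prod_eq_prod (fun j (y : UnitAddCircle) =>
    Complex.exp (inner ℝ (c j * fourier (-1) y : ℂ) ξ * Complex.I))]
  simp_rw [integral_exp_inner_fourier]
  push_cast
  rfl

end Torus

/-! ### Second moment, power sums and the product of Bessel means. -/

section FiniteFamily

variable {ι : Type*} [Fintype ι]

theorem integral_norm_sq_torusSum (c : ι → ℝ) :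
    ∫ x, ‖torusSum c x‖ ^ 2 ∂torusMeasure ι = ∑ j, c j ^ 2 := by
  classical
  have h : ∀ x : UnitAddTorus ι, ((‖torusSum c x‖ ^ 2 : ℝ) : ℂ) =
      ∑ j, ∑ k, (c j * c k : ℂ) *
        UnitAddTorus.mFourier (Pi.single k 1 + -Pi.single j 1) x := fun x => by
    push_cast
    rw [← Complex.mul_conj', torusSum, map_sum, Finset.sum_mul_sum]
    refine Finset.sum_congr rfl fun j _ => Finset.sum_congr rfl fun k _ => ?_
    rw [UnitAddTorus.mFourier_add, UnitAddTorus.mFourier_neg, UnitAddTorus.mFourier_single,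
      UnitAddTorus.mFourier_single, map_mul, fourier_neg, fourier_neg, Complex.conj_conj,
      Complex.conj_ofReal]
    ring
  have hint : ∀ j k : ι, Integrable (fun x => (c j * c k : ℂ) *
      UnitAddTorus.mFourier (Pi.single k 1 + -Pi.single j 1) x) (torusMeasure ι) := fun j k =>
    integrable_torusMeasure_of_continuous (by fun_prop)
  have hjk : ∀ j k : ι, (Pi.single k 1 + -Pi.single j 1 : ι → ℤ) = 0 ↔ j = k := fun j k => by
    rw [← sub_eq_add_neg, sub_eq_zero]
    refine ⟨fun h => ?_, fun h => by rw [h]⟩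
    by_contra hne
    have := congrFun h k
    rw [Pi.single_eq_same, Pi.single_eq_of_ne (Ne.symm hne)] at this
    exact one_ne_zero this
  rw [← Complex.ofReal_inj, ← integral_complex_ofReal]
  simp_rw [h]
  rw [integral_finsetSum _ fun j _ => integrable_finsetSum _ fun k _ => hint j k]
  push_cast
  refine Finset.sum_congr rfl fun j _ => ?_
  rw [integral_finsetSum _ fun k _ => hint j k]
  simp_rw [integral_const_mul, integral_mFourier_torusMeasure, hjk]
  simp [sq]

theorem hasTimeAverage_norm_sq {E : ι → ℝ} (hE : LinearIndependent ℚ E) (c : ι → ℝ) :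
    HasTimeAverage (fun t => ‖∑ j, (c j : ℂ) * Complex.exp (-Complex.I * t * E j)‖ ^ 2)
      (∑ j, c j ^ 2) := by
  have h := tendsto_average_torusFlow hE ⟨fun x => ((‖torusSum c x‖ ^ 2 : ℝ) : ℂ), by fun_prop⟩
  simp only [ContinuousMap.coe_mk, torusSum_torusFlow, intervalIntegral.integral_ofReal,
    integral_complex_ofReal, integral_norm_sq_torusSum] at h
  unfold HasTimeAverage
  exact_mod_cast Complex.continuous_re.continuousAt.tendsto.comp h

/-- Each `p j` is at most `(∑ p^q)^(1/q)`; pull `r - 1` powers of this bound out of `∑ p^r`. -/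
theorem sum_rpow_le_of_sum_eq_one {p : ι → ℝ} (hp : ∀ j, 0 ≤ p j) (hsum : ∑ j, p j = 1)
    {q r : ℝ} (hq : 0 < q) (hr : 1 < r) :
    ∑ j, p j ^ r ≤ (∑ j, p j ^ q) ^ ((r - 1) / q) := by
  have hnn : 0 ≤ ∑ j, p j ^ q := Finset.sum_nonneg fun j _ => Real.rpow_nonneg (hp j) q
  calc ∑ j, p j ^ r ≤ ∑ j, p j * (∑ j, p j ^ q) ^ ((r - 1) / q) := by
        refine Finset.sum_le_sum fun j _ => ?_
        have h1 : p j ^ q ≤ ∑ j, p j ^ q :=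
          Finset.single_le_sum (f := fun j => p j ^ q)
            (fun j _ => Real.rpow_nonneg (hp j) q) (Finset.mem_univ j)
        have h2 : p j ^ (r - 1) ≤ (∑ j, p j ^ q) ^ ((r - 1) / q) := by
          have := Real.rpow_le_rpow (Real.rpow_nonneg (hp j) q) h1
            (show 0 ≤ (r - 1) / q from div_nonneg (by linarith) hq.le)
          rwa [← Real.rpow_mul (hp j), mul_div_cancel₀ _ hq.ne'] at this
        rcases (hp j).eq_or_lt with h0 | h0
        · rw [← h0, Real.zero_rpow (by linarith), zero_mul]
        · have : p j ^ r = p j * p j ^ (r - 1) := by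
            rw [Real.rpow_sub_one h0.ne']; field_simp
          rw [this]
          exact mul_le_mul_of_nonneg_left h2 (hp j)
    _ = _ := by rw [← Finset.sum_mul, hsum, one_mul]

theorem prod_besselMean_bounds {c : ι → ℝ} (hc : ∑ j, c j ^ 2 = 1) {r : ℝ}
    (hr : ∀ j, |c j * r| ≤ 1) :
    Real.exp (-(r ^ 2 / 4 + r ^ 4 / 16 * ∑ j, c j ^ 4)) ≤ ∏ j, besselMean (c j * r) ∧
      ∏ j, besselMean (c j * r) ≤ Real.exp (-(r ^ 2 / 4 + r ^ 4 / 256 * ∑ j, c j ^ 4)) := by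
  have h : ∀ a : ℝ, Real.exp (-(r ^ 2 / 4 + r ^ 4 / a * ∑ j, c j ^ 4)) =
      ∏ j, Real.exp (-((c j * r) ^ 2 / 4 + (c j * r) ^ 4 / a)) := fun a => by
    rw [← Real.exp_sum, Finset.sum_neg_distrib, Finset.sum_add_distrib, Finset.mul_sum]
    congr 3
    · rw [← Finset.sum_div]
      simp_rw [mul_pow]
      rw [← Finset.sum_mul, hc, one_mul]
    · refine Finset.sum_congr rfl fun j _ => ?_
      ring
  rw [h, h]
  exact ⟨Finset.prod_le_prod (fun j _ => (Real.exp_pos _).le) fun j _ => exp_le_besselMean (hr j),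
    Finset.prod_le_prod (fun j _ => (Real.exp_pos _).le.trans (exp_le_besselMean (hr j)))
      fun j _ => besselMean_le_exp (hr j)⟩

end FiniteFamily

/-! ### Gaussian limits via characteristic functions. -/

theorem charFun_standardGaussian (ξ : ℂ) :
    charFun (standardGaussian : Measure ℂ) ξ = ((Real.exp (-(‖ξ‖ ^ 2 / 4)) : ℝ) : ℂ) := by
  have h := GaussianFourier.integral_cexp_neg_mul_sq_norm_add (V := ℂ) (b := 1) (by simp)
    Complex.I ξ
  rw [charFun_apply, standardGaussian, ProbabilityMeasure.coe_mk, gaussianMeasure,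
    integral_withDensity_eq_integral_toReal_smul (by fun_prop) (by simp)]
  have h2 : ∀ y : ℂ, (ENNReal.ofReal (1 / Real.pi * Real.exp (-‖y‖ ^ 2))).toReal •
      Complex.exp (inner ℝ y ξ * Complex.I) =
      (Real.pi : ℂ)⁻¹ * Complex.exp (-1 * ‖y‖ ^ 2 + Complex.I * inner ℝ ξ y) := fun y => by
    rw [ENNReal.toReal_ofReal (by positivity), real_inner_comm, Complex.real_smul, Complex.exp_add]
    push_cast
    ring_nf
  simp_rw [h2]
  rw [integral_const_mul, h, Complex.finrank_real_complex]
  push_cast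
  rw [Complex.I_sq]
  norm_num
  congr 1
  ring

section Sequence

variable {ι : ℕ → Type*} [∀ L, Fintype (ι L)] {c : ∀ L, ι L → ℝ}

theorem tendsto_circleSumLaw_standardGaussian (hc : ∀ L, ∑ j, c L j ^ 2 = 1)
    (h4 : Tendsto (fun L => ∑ j, c L j ^ 4) atTop (𝓝 0)) :
    Tendsto (fun L => circleSumLaw (c L)) atTop (𝓝 standardGaussian) := by
  refine ProbabilityMeasure.tendsto_of_tendsto_charFun fun ξ => ?_
  simp_rw [charFun_circleSumLaw, charFun_standardGaussian]
  refine (Complex.continuous_ofReal.tendsto _).comp ?_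
  generalize ‖ξ‖ = r
  have hlim : ∀ a : ℝ, Tendsto (fun L => Real.exp (-(r ^ 2 / 4 + r ^ 4 / a * ∑ j, c L j ^ 4)))
      atTop (𝓝 (Real.exp (-(r ^ 2 / 4)))) := fun a => by
    have := ((h4.const_mul (r ^ 4 / a)).const_add (r ^ 2 / 4)).neg
    rw [mul_zero, add_zero] at this
    exact (Real.continuous_exp.tendsto _).comp this
  -- The Bessel bounds need `|c_j r| ≤ 1`; for fixed `r` this holds eventually, since `∑ c_j⁴ → 0`
  -- forces `max |c_j| → 0`.
  have hsmall : ∀ᶠ L in atTop, ∀ j, |c L j * r| ≤ 1 := by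
    have := h4.mul_const (r ^ 4)
    rw [zero_mul] at this
    filter_upwards [this.eventually_le_const one_pos] with L hL j
    have h1 : c L j ^ 4 ≤ ∑ j, c L j ^ 4 :=
      Finset.single_le_sum (f := fun j => c L j ^ 4)
        (fun j _ => Even.pow_nonneg (by decide) _) (Finset.mem_univ j)
    have h2 : |c L j * r| ^ 4 ≤ 1 := by
      rw [Even.pow_abs (by decide), mul_pow]
      exact (mul_le_mul_of_nonneg_right h1 (Even.pow_nonneg (by decide) _)).trans hL
    exact (pow_le_one_iff_of_nonneg (abs_nonneg _) four_ne_zero).1 h2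
  refine tendsto_of_tendsto_of_tendsto_of_le_of_le' (hlim 16) (hlim 256) ?_ ?_
  · filter_upwards [hsmall] with L hL using (prod_besselMean_bounds (hc L) hL).1
  · filter_upwards [hsmall] with L hL using (prod_besselMean_bounds (hc L) hL).2

/-- The norm discards the phase due to the mean, and one real direction suffices, so the limit need
not be assumed centred, isotropic or nondegenerate. -/
theorem norm_charFun_ofReal_of_isGaussian (γ : Measure ℂ) [IsGaussian γ] (r : ℝ) :
    ‖charFun γ (r : ℂ)‖ = Real.exp (-(r ^ 2 * (Var[Complex.re; γ] / 2))) := by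
  have h : (fun x : ℂ => inner ℝ (r : ℂ) x) = fun x => r * x.re := by
    ext x
    simp [Complex.inner, mul_comm]
  rw [IsGaussian.charFun_eq, h, variance_const_mul, Complex.norm_exp]
  congr 1
  simp
  norm_cast
  ring

theorem tendsto_sum_pow_four_of_tendsto_isGaussian (hc : ∀ L, ∑ j, c L j ^ 2 = 1)
    {γ : ProbabilityMeasure ℂ} (hγ : IsGaussian (γ : Measure ℂ))
    (h : Tendsto (fun L => circleSumLaw (c L)) atTop (𝓝 γ)) :
    Tendsto (fun L => ∑ j, c L j ^ 4) atTop (𝓝 0) := by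
  rw [ProbabilityMeasure.tendsto_iff_tendsto_charFun] at h
  set v := Var[Complex.re; (γ : Measure ℂ)] / 2 with hv
  have hc1 : ∀ L j, c L j ^ 2 ≤ 1 := fun L j => by
    rw [← hc L]
    exact Finset.single_le_sum (f := fun j => c L j ^ 2)
      (fun j _ => sq_nonneg _) (Finset.mem_univ j)
  have hsmall : ∀ {r : ℝ}, 0 ≤ r → r ≤ 1 → ∀ L j, |c L j * r| ≤ 1 := fun {r} hr hr1 L j => by
    rw [abs_mul, abs_of_nonneg hr]
    exact mul_le_one₀ ((sq_le_one_iff_abs_le_one _).1 (hc1 L j)) hr hr1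
  have hsum0 : ∀ L, 0 ≤ ∑ j, c L j ^ 4 := fun L =>
    Finset.sum_nonneg fun j _ => Even.pow_nonneg (by decide) _
  have hsum1 : ∀ L, ∑ j, c L j ^ 4 ≤ 1 := fun L => by
    rw [← hc L]
    refine Finset.sum_le_sum fun j _ => ?_
    nlinarith [hc1 L j, sq_nonneg (c L j)]
  have hprod : ∀ {r : ℝ}, 0 ≤ r → r ≤ 1 →
      Tendsto (fun L => ∏ j, besselMean (c L j * r)) atTop (𝓝 (Real.exp (-(r ^ 2 * v)))) := by
    intro r hr hr1
    have h1 := (h r).norm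
    rw [norm_charFun_ofReal_of_isGaussian] at h1
    refine h1.congr fun L => ?_
    rw [charFun_circleSumLaw, Complex.norm_real, Complex.norm_real, Real.norm_of_nonneg hr,
      Real.norm_of_nonneg ((Real.exp_pos _).le.trans
        (prod_besselMean_bounds (hc L) (hsmall hr hr1 L)).1)]
  have hlow : ∀ {r : ℝ}, 0 ≤ r → r ≤ 1 → r ^ 2 * v ≤ r ^ 2 / 4 + r ^ 4 / 16 := by
    intro r hr hr1
    rw [← neg_le_neg_iff, ← Real.exp_le_exp]
    refine ge_of_tendsto (hprod hr hr1) (Eventually.of_forall fun L => ?_)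
    refine le_trans (Real.exp_le_exp.2 ?_) (prod_besselMean_bounds (hc L) (hsmall hr hr1 L)).1
    have : r ^ 4 / 16 * ∑ j, c L j ^ 4 ≤ r ^ 4 / 16 :=
      mul_le_of_le_one_right (by positivity) (hsum1 L)
    linarith
  have hup : 1 / 4 ≤ v := by
    have h1 : Real.exp (-((1 : ℝ) ^ 2 * v)) ≤ Real.exp (-(1 / 4)) := by
      refine le_of_tendsto (hprod zero_le_one le_rfl) (Eventually.of_forall fun L => ?_)
      refine (prod_besselMean_bounds (hc L) (hsmall zero_le_one le_rfl L)).2.trans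
        (Real.exp_le_exp.2 ?_)
      linarith [hsum0 L]
    have := Real.exp_le_exp.1 h1
    linarith
  have hv4 : v = 1 / 4 := by
    by_contra hne
    have hδ : 0 < v - 1 / 4 := sub_pos.2 (lt_of_le_of_ne hup (Ne.symm hne))
    have h1 := hlow zero_le_one le_rfl
    -- Testing at `r = δ = v - 1/4` gives `δ ≤ δ²/16`, impossible since `r = 1` gave `δ ≤ 1/16`.
    have h2 := hlow hδ.le (by linarith)
    have h3 : (v - 1 / 4) ^ 2 * (v - 1 / 4) ≤ (v - 1 / 4) ^ 2 * ((v - 1 / 4) ^ 2 / 16) := by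
      linarith
    have := le_of_mul_le_mul_left h3 (by positivity)
    nlinarith
  -- The upper Bessel bound at `r = 1`, solved for `∑ c_j⁴`, gives this majorant.
  have hlog : Tendsto (fun L => 256 * (-(1 / 4) - Real.log (∏ j, besselMean (c L j * 1))))
      atTop (𝓝 0) := by
    have h1 := (Real.continuousAt_log (Real.exp_pos _).ne').tendsto.comp
      (hprod zero_le_one le_rfl)
    rw [Real.log_exp, hv4] at h1
    have h2 := (h1.const_sub (-(1 / 4))).const_mul 256
    norm_num at h2 ⊢
    exact h2
  refine squeeze_zero hsum0 (fun L => ?_) hlog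
  obtain ⟨h1, h2⟩ := prod_besselMean_bounds (hc L) (hsmall zero_le_one le_rfl L)
  have h3 := Real.log_le_log ((Real.exp_pos _).trans_le h1) h2
  rw [Real.log_exp] at h3
  linarith

end Sequence

/-! ### Translation back to the spectral data. -/

/-- The weight `d_j / ΔZ_n` of a level in the rescaled walker. -/
noncomputable def normalizedWeight (S : SpectralData) (n : ℕ) (j : Fin S.numLevels) : ℝ :=
  (if j.val < n then S.weight j else 0) /
    Real.sqrt (∑ j : Fin S.numLevels with j.val < n, S.weight j ^ 2)

variable {S : SpectralData} {n : ℕ}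

theorem sum_weight_sq_pos (hn : 1 ≤ n) (hnN : n ≤ S.numLevels) :
    0 < ∑ j : Fin S.numLevels with j.val < n, S.weight j ^ 2 :=
  Finset.sum_pos (fun j _ => pow_pos (S.weight_pos j) 2)
    ⟨⟨0, by omega⟩, by simp; omega⟩

/-- Padding with zero weights keeps the index type `Fin S.numLevels`, so the torus results apply to
the full independent family of energies. -/
theorem position_eq_sum (S : SpectralData) (n : ℕ) (t : ℝ) :
    position S n t = ∑ j, ((if j.val < n then S.weight j else 0 : ℝ) : ℂ) *
      Complex.exp (-Complex.I * t * S.energy j) := by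
  rw [position, Finset.sum_filter]
  refine Finset.sum_congr rfl fun j _ => ?_
  split_ifs <;> simp

theorem hasTimeAverage_norm_sq_position (hE : LinearIndependent ℚ S.energy) (n : ℕ) :
    HasTimeAverage (fun t => ‖position S n t‖ ^ 2)
      (∑ j : Fin S.numLevels with j.val < n, S.weight j ^ 2) := by
  have h := hasTimeAverage_norm_sq hE fun j => if j.val < n then S.weight j else 0
  simp only [← position_eq_sum, ite_pow, ne_eq, OfNat.ofNat_ne_zero, not_false_eq_true, zero_pow]
    at h
  rwa [Finset.sum_filter]

theorem spread_eq (hE : LinearIndependent ℚ S.energy) (n : ℕ) :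
    spread S n = Real.sqrt (∑ j : Fin S.numLevels with j.val < n, S.weight j ^ 2) := by
  rw [spread, timeAverage, (hasTimeAverage_norm_sq_position hE n).limUnder_eq]

theorem isTimeLaw_rescaled (hE : LinearIndependent ℚ S.energy) (n : ℕ) :
    IsTimeLaw (rescaled S n) (circleSumLaw (normalizedWeight S n)) := by
  convert isTimeLaw_circleSumLaw hE (normalizedWeight S n) using 2 with t
  rw [rescaled, spread_eq hE, position_eq_sum, Finset.sum_div]
  refine Finset.sum_congr rfl fun j _ => ?_
  rw [normalizedWeight, Complex.ofReal_div]
  ring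

theorem sum_normalizedWeight_sq (hn : 1 ≤ n) (hnN : n ≤ S.numLevels) :
    ∑ j, normalizedWeight S n j ^ 2 = 1 := by
  have hpos := sum_weight_sq_pos hn hnN
  simp_rw [normalizedWeight, div_pow, Real.sq_sqrt hpos.le]
  rw [← Finset.sum_div, div_eq_one_iff_eq hpos.ne', Finset.sum_filter]
  refine Finset.sum_congr rfl fun j _ => ?_
  split_ifs <;> simp

theorem lyapunovRatio_eq (hn : 1 ≤ n) (hnN : n ≤ S.numLevels) {q : ℝ} (hq : 0 < q) :
    lyapunovRatio S n q = ∑ j, (normalizedWeight S n j ^ 2) ^ q := by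
  have hpos := sum_weight_sq_pos hn hnN
  simp_rw [normalizedWeight, div_pow, Real.sq_sqrt hpos.le]
  rw [lyapunovRatio, Finset.sum_filter, Finset.sum_div]
  refine Finset.sum_congr rfl fun j _ => ?_
  rw [Real.div_rpow (by positivity) hpos.le]
  congr 1
  split_ifs
  · rw [Real.rpow_mul (S.weight_pos j).le, Real.rpow_two]
  · rw [zero_pow two_ne_zero, Real.zero_rpow hq.ne']

theorem lyapunovRatio_two (hn : 1 ≤ n) (hnN : n ≤ S.numLevels) :
    lyapunovRatio S n 2 = ∑ j, normalizedWeight S n j ^ 4 := by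
  rw [lyapunovRatio_eq hn hnN two_pos]
  refine Finset.sum_congr rfl fun j _ => ?_
  rw [Real.rpow_two, ← pow_mul]

theorem LyapunovCondition.tendsto_lyapunovRatio {S : ℕ → SpectralData} {n : ℕ → ℕ}
    (hn : ∀ L, 1 ≤ n L ∧ n L ≤ (S L).numLevels) (h : LyapunovCondition S n) {p : ℝ} (hp : 1 < p) :
    Tendsto (fun L => lyapunovRatio (S L) (n L) p) atTop (𝓝 0) := by
  obtain ⟨q, hq, h⟩ := h
  have hq0 : 0 < q := one_pos.trans hq
  have hexp : 0 < (p - 1) / q := div_pos (by linarith) hq0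
  have hlim := h.rpow_const (p := (p - 1) / q) (Or.inr hexp.le)
  rw [Real.zero_rpow hexp.ne'] at hlim
  refine squeeze_zero (fun L => ?_) (fun L => ?_) hlim
  · rw [lyapunovRatio_eq (hn L).1 (hn L).2 (one_pos.trans hp)]
    exact Finset.sum_nonneg fun j _ => Real.rpow_nonneg (sq_nonneg _) _
  · rw [lyapunovRatio_eq (hn L).1 (hn L).2 (one_pos.trans hp),
      lyapunovRatio_eq (hn L).1 (hn L).2 hq0]
    exact sum_rpow_le_of_sum_eq_one (fun j => sq_nonneg _)
      (sum_normalizedWeight_sq (hn L).1 (hn L).2) hq0 hp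

end SpectralWalk

theorem theorem2
    (S : ℕ → SpectralWalk.SpectralData) (n : ℕ → ℕ)
    (hn : ∀ L, 1 ≤ n L ∧ n L ≤ (S L).numLevels)
    (hE : ∀ L, LinearIndependent ℚ (S L).energy) :
    -- the normalisation is well defined: the time average of the squared modulus exists
    (∀ L, SpectralWalk.HasTimeAverage
      (fun t => ‖SpectralWalk.position (S L) (n L) t‖ ^ 2)
      (∑ j : Fin (S L).numLevels with j.val < n L, (S L).weight j ^ 2)) ∧
    -- the time-averaged distribution of each rescaled walker exists and is unique
    (∀ L, ∃! P : ProbabilityMeasure ℂ,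
      SpectralWalk.IsTimeLaw (SpectralWalk.rescaled (S L) (n L)) P) ∧
    -- convergence to the standard Gaussian, and the converse
    (∀ P : ℕ → ProbabilityMeasure ℂ,
      (∀ L, SpectralWalk.IsTimeLaw (SpectralWalk.rescaled (S L) (n L)) (P L)) →
      (SpectralWalk.LyapunovCondition S n →
        Tendsto P atTop (𝓝 SpectralWalk.standardGaussian)) ∧
      (¬ SpectralWalk.LyapunovCondition S n →
        ∀ γ : ProbabilityMeasure ℂ, IsGaussian (γ : Measure ℂ) →
          ¬ Tendsto P atTop (𝓝 γ))) ∧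
    -- the condition for one exponent implies it for all
    (SpectralWalk.LyapunovCondition S n →
      ∀ p : ℝ, 1 < p →
        Tendsto (fun L => SpectralWalk.lyapunovRatio (S L) (n L) p) atTop (𝓝 0)) := by
  have hlaw : ∀ L, SpectralWalk.IsTimeLaw (SpectralWalk.rescaled (S L) (n L))
      (SpectralWalk.circleSumLaw (SpectralWalk.normalizedWeight (S L) (n L))) := fun L =>
    SpectralWalk.isTimeLaw_rescaled (hE L) (n L)
  have hsq := fun L => SpectralWalk.sum_normalizedWeight_sq (hn L).1 (hn L).2
  refine ⟨fun L => SpectralWalk.hasTimeAverage_norm_sq_position (hE L) (n L),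
    fun L => ⟨_, hlaw L, fun Q hQ => hQ.unique (hlaw L)⟩, fun P hP => ?_,
    fun h p hp => h.tendsto_lyapunovRatio hn hp⟩
  -- Uniqueness of time laws replaces the arbitrary `P` by the explicit circle-sum laws.
  obtain rfl : P = fun L =>
      SpectralWalk.circleSumLaw (SpectralWalk.normalizedWeight (S L) (n L)) :=
    funext fun L => (hP L).unique (hlaw L)
  refine ⟨fun h => ?_, fun h γ hγ hlim => h ⟨2, one_lt_two, ?_⟩⟩
  · refine SpectralWalk.tendsto_circleSumLaw_standardGaussian hsq ?_
    exact (h.tendsto_lyapunovRatio hn one_lt_two).congr fun L =>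
      SpectralWalk.lyapunovRatio_two (hn L).1 (hn L).2
  · exact (SpectralWalk.tendsto_sum_pow_four_of_tendsto_isGaussian hsq hγ hlim).congr fun L =>
      (SpectralWalk.lyapunovRatio_two (hn L).1 (hn L).2).symm
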